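/- Let $\Lambda$ be the ring of symmetric functions over $\mathbb{Q}(q)$ in infinitely many variables $X=(x_0,x_1,x_2,\dots)$, i.e. the formal power series of bounded degree that are invariant under all permutations of the variables. For a partition $\mu$ let $m_\mu\in\Lambda$ be the monomial symmetric function, let $h_r\in\Lambda$ be the complete homogeneous symmetric function of degree $r$, and let $p_r=\sum_i x_i^r$ be the power sums, so that $\Lambda=\mathbb{Q}(q)[p_1,p_2,\dots]$. For an integer $a\ge 0$ let $C_a:\Lambda\to\Lambda$ be the Haglund–Morse–Zabrocki operator $$C_a\,P[X]=\left(-\frac1q\right)^{a-1}P\!\left[X-\frac{1-1/q}{z}\right]\sum_{r\ge 0}z^r h_r[X]\;\Big|_{z^a},$$ where $P\mapsto P[X-\frac{1-1/q}{z}]$ is the $\mathbb{Q}(q)$-algebra homomorphism determined by $p_r\mapsto p_r-(1-q^{-r})z^{-r}$ for $r\ge 1$, and $|_{z^a}$ denotes the coefficient of $z^a$ of a formal Laurent series in $z$. For a composition $\alpha=(\alpha_1,\dots,\alpha_\ell)$, write $\alpha\models N$ if its (positive) parts sum to $N$, and put $C_\alpha=C_{\alpha_1}\circ\cdots\circ C_{\alpha_\ell}$;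 the empty composition is the only composition of $0$, and its operator is the identity. **Theorem 4.1.** Let $n\ge 2$ and $k\ge 1$ be integers, and let $(n,1^k)$ be the partition with one part $n$ and $k$ parts $1$. Then $$(-1)^{n-1}m_{(n,1^k)}=\sum_{a=1}^{n}\Bigl(k+1+\sum_{i=1}^{a-1}q^{\,n-i}\Bigr)\sum_{\tau\models n-a}\;\sum_{b=0}^{k}\;\sum_{\rho\models k-b}C_\tau\,C_{a+b}\,C_\rho\,1 .$$ -/

import Mathlib

noncomputable section

namespace SymFn

open MvPowerSeries

/-- The ring of symmetric functions over `K` in the variables `x₀, x₁, x₂, …`: the formal power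
series of bounded degree that are invariant under every permutation of the variables. -/
def Sym (K : Type) [CommRing K] : Subalgebra K (MvPowerSeries ℕ K) where
  carrier := {f | (∀ σ : Equiv.Perm ℕ, rename σ f = f) ∧
    ∃ N : ℕ, ∀ d : ℕ →₀ ℕ, N < d.degree → coeff d f = 0}
  mul_mem' := by
    rintro f g ⟨hf, M, hM⟩ ⟨hg, N, hN⟩
    refine ⟨fun σ => by rw [map_mul, hf, hg], M + N, fun d hd => ?_⟩
    classical
    rw [coeff_mul]
    refine Finset.sum_eq_zero fun x hx => ?_
    rw [Finset.HasAntidiagonal.mem_antidiagonal] at hx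
    have h1 : d.degree = x.1.degree + x.2.degree := by rw [← hx, map_add]
    by_cases h2 : M < x.1.degree
    · rw [hM _ h2, zero_mul]
    · rw [hN _ (by omega), mul_zero]
  add_mem' := by
    rintro f g ⟨hf, M, hM⟩ ⟨hg, N, hN⟩
    refine ⟨fun σ => by rw [map_add, hf, hg], M + N, fun d hd => ?_⟩
    rw [map_add, hM _ (by omega), hN _ (by omega), add_zero]
  algebraMap_mem' := by
    intro r
    refine ⟨fun σ => AlgHom.commutes _ r, 0, fun d hd => ?_⟩
    classical
    rw [MvPowerSeries.algebraMap_apply, Algebra.algebraMap_self, RingHom.id_apply, coeff_C, if_neg]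
    rintro rfl
    simp at hd

theorem coeff_perm {K : Type} [CommRing K] {f : MvPowerSeries ℕ K}
    (hf : ∀ σ : Equiv.Perm ℕ, rename σ f = f) (σ : Equiv.Perm ℕ) (d : ℕ →₀ ℕ) :
    coeff (d.embDomain σ.toEmbedding) f = coeff d f := by
  conv_lhs => rw [← hf σ]
  exact coeff_embDomain_rename σ.toEmbedding f d

theorem rename_eq_of_coeff {K : Type} [CommRing K] {f : MvPowerSeries ℕ K}
    (hf : ∀ (σ : Equiv.Perm ℕ) (d : ℕ →₀ ℕ), coeff (d.embDomain σ.toEmbedding) f = coeff d f)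
    (σ : Equiv.Perm ℕ) : rename σ f = f := by
  ext d
  have h : d = (d.embDomain σ.symm.toEmbedding).embDomain σ.toEmbedding := by
    ext i
    obtain ⟨j, rfl⟩ := σ.surjective i
    obtain ⟨l, rfl⟩ := σ.symm.surjective j
    have h1 := Finsupp.embDomain_apply_self σ.toEmbedding (d.embDomain σ.symm.toEmbedding)
      (σ.symm l)
    have h2 := Finsupp.embDomain_apply_self σ.symm.toEmbedding d l
    simp only [Equiv.coe_toEmbedding, Equiv.apply_symm_apply] at h1 h2 ⊢
    rw [h1, h2]
  rw [h, hf]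
  exact coeff_embDomain_rename σ.toEmbedding f _

/-- The exponents of the monomial `x ^ d`, as a multiset of positive integers. -/
def parts (d : ℕ →₀ ℕ) : Multiset ℕ := d.support.val.map d

theorem parts_embDomain (d : ℕ →₀ ℕ) (σ : ℕ ↪ ℕ) : parts (d.embDomain σ) = parts d := by
  simp [parts, Finsupp.support_embDomain, Multiset.map_map]

theorem sum_parts (d : ℕ →₀ ℕ) : (parts d).sum = d.degree := rfl

/-- The monomial symmetric function `m_μ`: the sum of all monomials whose multiset of exponents is
the partition `μ`, given as the multiset of its parts. -/
def m (K : Type) [CommRing K] (μ : Multiset ℕ) : Sym K :=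
  ⟨fun d => by classical exact if parts d = μ then 1 else 0,
    rename_eq_of_coeff fun σ d => by
      change ite _ _ _ = ite _ _ _
      rw [parts_embDomain],
    μ.sum, fun d hd => by
      change ite _ _ _ = _
      rw [if_neg]
      rintro rfl
      rw [sum_parts] at hd
      exact lt_irrefl _ hd⟩

/-- The complete homogeneous symmetric function `h_r`: the sum of all monomials of degree `r`. -/
def h (K : Type) [CommRing K] (r : ℕ) : Sym K :=
  ⟨fun d => if d.degree = r then 1 else 0,
    rename_eq_of_coeff fun σ d => by
      change ite _ _ _ = ite _ _ _
      rw [← sum_parts, parts_embDomain, sum_parts],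
    r, fun d hd => by
      change ite _ _ _ = _
      rw [if_neg (by omega)]⟩

/-- The power sum `p_r = m_(r) = ∑ᵢ xᵢ ^ r` (for `r ≥ 1`). -/
def p (K : Type) [CommRing K] (r : ℕ) : Sym K := m K {r}

theorem parts_eq_singleton (d : ℕ →₀ ℕ) (r : ℕ) :
    parts d = {r + 1} ↔ ∃ i, d = Finsupp.single i (r + 1) := by
  constructor
  · intro hd
    have h1 : d.support.card = 1 := by
      have := congrArg Multiset.card hd
      simpa [parts] using this
    obtain ⟨i, b, hb, rfl⟩ := Finsupp.card_support_eq_one'.1 h1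
    refine ⟨i, ?_⟩
    rw [parts, Finsupp.support_single i hb] at hd
    simp at hd
    rw [hd]
  · rintro ⟨i, rfl⟩
    rw [parts, Finsupp.support_single i (by omega)]
    simp

/-- Setting all variables but `x₀, …, x_{n-1}` to zero. -/
abbrev res (K : Type) [CommRing K] (n : ℕ) : MvPowerSeries ℕ K →ₐ[K] MvPowerSeries (Fin n) K :=
  killCompl Fin.valEmbedding

theorem res_p (K : Type) [CommRing K] (n r : ℕ) :
    res K n (p K (r + 1)) = (MvPolynomial.psum (Fin n) K (r + 1) : MvPowerSeries (Fin n) K) := by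
  classical
  ext d
  rw [coeff_killCompl, MvPolynomial.coeff_coe, MvPolynomial.psum, MvPolynomial.coeff_sum]
  change ite _ _ _ = _
  simp only [MvPolynomial.coeff_X_pow]
  split_ifs with hd
  · obtain ⟨i, hi⟩ := (parts_eq_singleton _ _).1 hd
    have hi' : i ∈ (d.embDomain Fin.valEmbedding).support := by
      rw [hi, Finsupp.support_single i (by omega)]
      simp
    rw [Finsupp.support_embDomain, Finset.mem_map] at hi'
    obtain ⟨j, -, rfl⟩ := hi'
    rw [← Finsupp.embDomain_single, Finsupp.embDomain_inj] at hi
    subst hi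
    rw [Finset.sum_eq_single j]
    · simp
    · intro b _ hb
      rw [if_neg]
      intro h1
      exact hb (Finsupp.single_left_injective (by omega) h1)
    · simp
  · symm
    refine Finset.sum_eq_zero fun i _ => if_neg ?_
    rintro rfl
    apply hd
    rw [Finsupp.embDomain_single]
    exact (parts_eq_singleton _ _).2 ⟨_, rfl⟩

theorem injective_of_surjective {R : Type} [CommRing R] [IsNoetherianRing R] (φ : R →+* R)
    (hφ : Function.Surjective φ) : Function.Injective φ := by
  let f : ℕ →o Ideal R := ⟨fun k => RingHom.ker (φ ^ k), monotone_nat_of_le_succ fun k x hx => by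
    rw [RingHom.mem_ker] at hx ⊢
    rw [pow_succ', RingHom.mul_def, RingHom.comp_apply, hx, map_zero]⟩
  obtain ⟨n, hn⟩ := monotone_stabilizes_iff_noetherian.2 (inferInstance : IsNoetherian R R) f
  rw [injective_iff_map_eq_zero]
  intro x hx
  have hs : Function.Surjective (φ ^ n : R →+* R) := by
    rw [RingHom.coe_pow]
    exact hφ.iterate n
  obtain ⟨y, rfl⟩ := hs x
  have hy : y ∈ f (n + 1) := by
    change y ∈ RingHom.ker (φ ^ (n + 1))
    rw [RingHom.mem_ker, pow_succ', RingHom.mul_def, RingHom.comp_apply, hx]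
  rw [← hn (n + 1) (Nat.le_succ n)] at hy
  exact hy

section Finite

variable (K : Type) [Field K] [CharZero K] (n : ℕ)

/-- The evaluation at the first `n` power sums of `n` variables. -/
def finEval : MvPolynomial (Fin n) K →ₐ[K] MvPolynomial.symmetricSubalgebra (Fin n) K :=
  MvPolynomial.aeval fun i : Fin n =>
    ⟨MvPolynomial.psum (Fin n) K (i + 1), MvPolynomial.psum_isSymmetric (Fin n) K _⟩

theorem esymm_mem (r : ℕ) (hr : r ≤ n) :
    (⟨MvPolynomial.esymm (Fin n) K r, MvPolynomial.esymm_isSymmetric (Fin n) K r⟩ :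
      MvPolynomial.symmetricSubalgebra (Fin n) K) ∈ (finEval K n).range := by
  induction r using Nat.strong_induction_on with
  | _ r ih =>
    rcases Nat.eq_zero_or_pos r with rfl | hpos
    · convert! one_mem (finEval K n).range
      exact Subtype.ext (MvPolynomial.esymm_zero (Fin n) K)
    have key := MvPolynomial.mul_esymm_eq_sum (Fin n) K r
    have hsum : (⟨∑ a ∈ Finset.HasAntidiagonal.antidiagonal r with a.1 < r,
        (-1) ^ a.1 * MvPolynomial.esymm (Fin n) K a.1 * MvPolynomial.psum (Fin n) K a.2,
        Subalgebra.sum_mem _ fun a _ => Subalgebra.mul_mem _ (Subalgebra.mul_mem _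
          (Subalgebra.pow_mem _ (Subalgebra.neg_mem _ (Subalgebra.one_mem _)) _)
          (MvPolynomial.esymm_isSymmetric (Fin n) K _))
          (MvPolynomial.psum_isSymmetric (Fin n) K _)⟩ :
        MvPolynomial.symmetricSubalgebra (Fin n) K) ∈ (finEval K n).range := by
      have : ∀ a ∈ (Finset.HasAntidiagonal.antidiagonal r).filter (fun a => a.1 < r),
          ((-1) ^ a.1 * ⟨MvPolynomial.esymm (Fin n) K a.1,
            MvPolynomial.esymm_isSymmetric (Fin n) K _⟩ *
            ⟨MvPolynomial.psum (Fin n) K a.2, MvPolynomial.psum_isSymmetric (Fin n) K _⟩ :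
            MvPolynomial.symmetricSubalgebra (Fin n) K) ∈ (finEval K n).range := by
        intro a ha
        rw [Finset.mem_filter, Finset.HasAntidiagonal.mem_antidiagonal] at ha
        refine Subalgebra.mul_mem _ (Subalgebra.mul_mem _ (Subalgebra.pow_mem _
          (Subalgebra.neg_mem _ (Subalgebra.one_mem _)) _) (ih _ ha.2 (by omega))) ?_
        refine ⟨MvPolynomial.X ⟨a.2 - 1, by omega⟩, ?_⟩
        apply Subtype.ext
        have : a.2 - 1 + 1 = a.2 := by omega
        simp [finEval, this]
      convert! Subalgebra.sum_mem _ this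
      simp
    have hr0 : (r : K) ≠ 0 := by exact_mod_cast hpos.ne'
    have := Subalgebra.smul_mem _ (Subalgebra.mul_mem _ (Subalgebra.pow_mem _ (Subalgebra.neg_mem _
      (Subalgebra.one_mem _)) (r + 1)) hsum) (r : K)⁻¹
    convert! this
    apply Subtype.ext
    simp only [SetLike.val_smul, MulMemClass.coe_mul, SubmonoidClass.coe_pow]
    change MvPolynomial.esymm (Fin n) K r = (r : K)⁻¹ • ((-1) ^ (r + 1) * _)
    rw [← key, MvPolynomial.smul_eq_C_mul, ← mul_assoc, ← map_natCast MvPolynomial.C, ← map_mul,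
      inv_mul_cancel₀ hr0, map_one, one_mul]

theorem finEval_surjective : Function.Surjective (finEval K n) := by
  intro f
  obtain ⟨g, rfl⟩ := MvPolynomial.esymmAlgHom_surjective (σ := Fin n) K (n := n) (by simp) f
  rw [← AlgHom.mem_range]
  induction g using MvPolynomial.induction_on with
  | C a => rw [← MvPolynomial.algebraMap_eq, AlgHom.commutes]; exact Subalgebra.algebraMap_mem _ _
  | add f g hf hg => rw [map_add]; exact Subalgebra.add_mem _ hf hg
  | mul_X f i hf =>
    rw [map_mul]
    refine Subalgebra.mul_mem _ hf ?_
    rw [MvPolynomial.esymmAlgHom, MvPolynomial.aeval_X]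
    exact esymm_mem K n _ i.2

theorem finEval_injective : Function.Injective (finEval K n) := by
  let e := MvPolynomial.esymmAlgEquiv (Fin n) K (n := n) (by simp)
  let φ : MvPolynomial (Fin n) K →ₐ[K] MvPolynomial (Fin n) K :=
    e.symm.toAlgHom.comp (finEval K n)
  have hφ : Function.Surjective φ := e.symm.surjective.comp (finEval_surjective K n)
  have h2 : Function.Injective (e.symm ∘ finEval K n) :=
    injective_of_surjective φ.toRingHom hφ
  exact Function.Injective.of_comp h2

end Finite

/-- The algebra homomorphism from the polynomial ring in infinitely many indeterminates that sends
the `i`-th indeterminate to the power sum `p_{i+1}`. -/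
def evalPowerSums (K : Type) [CommRing K] : MvPolynomial ℕ K →ₐ[K] Sym K :=
  MvPolynomial.aeval fun i => p K (i + 1)

theorem res_eval (K : Type) [Field K] [CharZero K] (n : ℕ) (F : MvPolynomial (Fin n) K) :
    res K n (evalPowerSums K (MvPolynomial.rename Fin.val F)) =
      ((finEval K n F : MvPolynomial (Fin n) K) : MvPowerSeries (Fin n) K) := by
  have h : ((res K n).comp (Sym K).val).comp
        ((evalPowerSums K).comp (MvPolynomial.rename Fin.val)) =
      (MvPolynomial.coeToMvPowerSeries.algHom K).comp
        ((MvPolynomial.symmetricSubalgebra (Fin n) K).val.comp (finEval K n)) := by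
    refine MvPolynomial.algHom_ext fun i => ?_
    simp [evalPowerSums, finEval, res_p]
  simpa using DFunLike.congr_fun h F

theorem evalPowerSums_injective (K : Type) [Field K] [CharZero K] :
    Function.Injective (evalPowerSums K) := by
  rw [injective_iff_map_eq_zero]
  intro F hF
  obtain ⟨n, G, rfl⟩ : ∃ (n : ℕ) (G : MvPolynomial (Fin n) K),
      F = MvPolynomial.rename Fin.val G := by
    obtain ⟨l, f, -, G, rfl⟩ := MvPolynomial.exists_fin_rename F
    refine ⟨Finset.univ.sup f + 1, MvPolynomial.rename (fun i => ⟨f i, Nat.lt_succ_of_le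
      (Finset.le_sup (Finset.mem_univ i))⟩) G, ?_⟩
    rw [MvPolynomial.rename_rename]
    rfl
  have h1 := res_eval K n G
  rw [hF, ZeroMemClass.coe_zero, map_zero, eq_comm, MvPolynomial.coe_eq_zero_iff,
    ZeroMemClass.coe_eq_zero] at h1
  rw [(injective_iff_map_eq_zero _).1 (finEval_injective K n) G h1, map_zero]

/-- The part of degree at most `N` of a symmetric function. -/
def cut (K : Type) [CommRing K] (N : ℕ) : Sym K →ₗ[K] Sym K where
  toFun f := ⟨fun d => if d.degree ≤ N then coeff d f.1 else 0,
    rename_eq_of_coeff fun σ d => by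
      change ite _ _ _ = ite _ _ _
      rw [← sum_parts, parts_embDomain, sum_parts, coeff_perm f.2.1],
    N, fun d hd => by
      change ite _ _ _ = _
      rw [if_neg (by omega)]⟩
  map_add' f g := by
    refine Subtype.ext (MvPowerSeries.ext fun d => ?_)
    change (if d.degree ≤ N then coeff d (f.1 + g.1) else 0) =
      (if d.degree ≤ N then coeff d f.1 else 0) + (if d.degree ≤ N then coeff d g.1 else 0)
    split_ifs <;> simp
  map_smul' c f := by
    refine Subtype.ext (MvPowerSeries.ext fun d => ?_)
    change (if d.degree ≤ N then coeff d (c • f.1) else 0) =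
      c * (if d.degree ≤ N then coeff d f.1 else 0)
    split_ifs <;> simp

theorem coeff_cut (K : Type) [CommRing K] (N : ℕ) (f : Sym K) (d : ℕ →₀ ℕ) :
    coeff d (cut K N f).1 = if d.degree ≤ N then coeff d f.1 else 0 := rfl

/-- Every product of power sums is homogeneous. -/
theorem eval_monomial (K : Type) [CommRing K] (s : ℕ →₀ ℕ) (a : K) :
    ∃ r : ℕ, ∀ d : ℕ →₀ ℕ, d.degree ≠ r →
      coeff d (evalPowerSums K (MvPolynomial.monomial s a)).1 = 0 := by
  classical
  let P : MvPowerSeries ℕ K → Prop := fun f => ∃ r : ℕ, ∀ d : ℕ →₀ ℕ, d.degree ≠ r → coeff d f = 0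
  have hmul : ∀ f g, P f → P g → P (f * g) := by
    rintro f g ⟨r, hr⟩ ⟨t, ht⟩
    refine ⟨r + t, fun d hd => ?_⟩
    rw [coeff_mul]
    refine Finset.sum_eq_zero fun x hx => ?_
    rw [Finset.HasAntidiagonal.mem_antidiagonal] at hx
    have h1 : d.degree = x.1.degree + x.2.degree := by rw [← hx, map_add]
    by_cases h2 : x.1.degree = r
    · rw [ht x.2 (by omega), mul_zero]
    · rw [hr _ h2, zero_mul]
  change P (evalPowerSums K (MvPolynomial.monomial s a)).1
  refine MvPolynomial.induction_on_monomial
    (motive := fun F => P (evalPowerSums K F).1) (fun c => ⟨0, fun d hd => ?_⟩)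
    (fun F i hF => ?_) s a
  · rw [← MvPolynomial.algebraMap_eq, AlgHom.commutes]
    change coeff d (algebraMap K (MvPowerSeries ℕ K) c) = 0
    rw [MvPowerSeries.algebraMap_apply, Algebra.algebraMap_self, RingHom.id_apply, coeff_C, if_neg]
    rintro rfl
    simp at hd
  · rw [map_mul]
    refine hmul _ _ hF ⟨i + 1, fun d hd => ?_⟩
    rw [evalPowerSums, MvPolynomial.aeval_X]
    change ite _ _ _ = _
    rw [if_neg]
    intro h1
    apply hd
    rw [← sum_parts, h1, Multiset.sum_singleton]

theorem cut_mem_range (K : Type) [CommRing K] (N : ℕ) (F : MvPolynomial ℕ K) :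
    cut K N (evalPowerSums K F) ∈ (evalPowerSums K).range := by
  induction F using MvPolynomial.induction_on' with
  | monomial s a =>
    obtain ⟨r, hr⟩ := eval_monomial K s a
    by_cases hN : r ≤ N
    · refine ⟨MvPolynomial.monomial s a, Subtype.ext (MvPowerSeries.ext fun d => ?_)⟩
      rw [coeff_cut]
      split_ifs with hd
      · rfl
      · exact hr d (by omega)
    · convert! Subalgebra.zero_mem _
      refine Subtype.ext (MvPowerSeries.ext fun d => ?_)
      rw [coeff_cut]
      split_ifs with hd
      · exact hr d (by omega)
      · rfl
  | add F G hF hG =>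
    rw [map_add, map_add]
    exact Subalgebra.add_mem _ hF hG

/-- A monomial of degree at most `N` can be moved to the first `N` variables. -/
theorem exists_perm (N : ℕ) (d : ℕ →₀ ℕ) (hd : d.degree ≤ N) :
    ∃ (σ : Equiv.Perm ℕ) (t : Fin N →₀ ℕ),
      d.embDomain σ.toEmbedding = t.embDomain Fin.valEmbedding := by
  have hcard : d.support.card ≤ N := by
    refine le_trans ?_ hd
    rw [Finsupp.degree_apply, Finset.card_eq_sum_ones]
    exact Finset.sum_le_sum fun i hi => Nat.one_le_iff_ne_zero.2 (Finsupp.mem_support_iff.1 hi)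
  let e := d.support.equivFin
  obtain ⟨σ, hσ⟩ := (MulAction.isMultiplyPretransitive_iff.1
    (Equiv.Perm.isMultiplyPretransitive ℕ d.support.card))
    (e.symm.toEmbedding.trans (Function.Embedding.subtype _)) Fin.valEmbedding
  refine ⟨σ, (d.embDomain σ.toEmbedding).comapDomain Fin.valEmbedding
    Fin.valEmbedding.injective.injOn, ?_⟩
  rw [Finsupp.embDomain_comapDomain]
  intro i hi
  rw [Finset.mem_coe, Finsupp.support_embDomain, Finset.mem_map] at hi
  obtain ⟨j, hj, rfl⟩ := hi
  have h1 := DFunLike.congr_fun hσ (e ⟨j, hj⟩)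
  have h2 : σ j = (e ⟨j, hj⟩ : ℕ) := by simpa using h1
  refine ⟨⟨σ j, ?_⟩, rfl⟩
  rw [h2]
  exact (e ⟨j, hj⟩).2.trans_le hcard

theorem degree_embDomain {n : ℕ} (d : Fin n →₀ ℕ) :
    (d.embDomain Fin.valEmbedding).degree = d.degree := by
  rw [Finsupp.embDomain_eq_mapDomain]
  simp

theorem exists_res (K : Type) [CommRing K] (N : ℕ) (f : Sym K)
    (hf : ∀ d : ℕ →₀ ℕ, N < d.degree → coeff d f.1 = 0) :
    ∃ g : MvPolynomial.symmetricSubalgebra (Fin N) K,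
      ((g : MvPolynomial (Fin N) K) : MvPowerSeries (Fin N) K) = res K N f := by
  classical
  let c : Fin N →₀ ℕ := Finsupp.equivFunOnFinite.symm fun _ => N
  let g : MvPolynomial (Fin N) K := truncFinset K (Finset.Iic c) (res K N f)
  have hg : ∀ d : Fin N →₀ ℕ, g.coeff d = coeff (d.embDomain Fin.valEmbedding) f.1 := by
    intro d
    rw [← coeff_killCompl]
    by_cases hd : d ∈ Finset.Iic c
    · exact coeff_truncFinset_of_mem _ hd
    · refine (coeff_truncFinset_eq_zero _ hd).trans ?_
      rw [coeff_killCompl, hf]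
      rw [degree_embDomain]
      by_contra! h1
      apply hd
      rw [Finset.mem_Iic]
      intro i
      exact (Finsupp.le_degree i d).trans h1
  refine ⟨⟨g, fun e => ?_⟩, ?_⟩
  · refine MvPolynomial.ext _ _ fun d => ?_
    obtain ⟨t, rfl⟩ := Finsupp.mapDomain_surjective e.surjective d
    rw [MvPolynomial.coeff_rename_mapDomain _ e.injective, hg, hg]
    rw [← coeff_perm f.2.1 (e.viaFintypeEmbedding Fin.valEmbedding)]
    congr 2
    simp only [Finsupp.embDomain_eq_mapDomain, ← Finsupp.mapDomain_comp]
    congr 1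
    funext i
    exact Equiv.Perm.viaFintypeEmbedding_apply_image e Fin.valEmbedding i
  · ext d
    rw [MvPolynomial.coeff_coe, hg, coeff_killCompl]

theorem evalPowerSums_surjective (K : Type) [Field K] [CharZero K] :
    Function.Surjective (evalPowerSums K) := by
  intro f
  obtain ⟨N, hN⟩ := f.2.2
  obtain ⟨g, hg⟩ := exists_res K N f hN
  obtain ⟨G, rfl⟩ := finEval_surjective K N g
  rw [← res_eval] at hg
  rw [← AlgHom.mem_range]
  convert! cut_mem_range K N (MvPolynomial.rename Fin.val G) using 1
  refine Subtype.ext (MvPowerSeries.ext fun d => ?_)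
  rw [coeff_cut]
  split_ifs with hd
  · obtain ⟨σ, t, ht⟩ := exists_perm N d hd
    rw [← coeff_perm f.2.1 σ, ← coeff_perm (evalPowerSums K _).2.1 σ, ht, ← coeff_killCompl,
      ← coeff_killCompl, hg]
  · exact hN d (by omega)

/-- Over a field of characteristic zero the symmetric functions form the polynomial ring in the
power sums `p₁, p₂, …`. -/
def powerSumEquiv (K : Type) [Field K] [CharZero K] : MvPolynomial ℕ K ≃ₐ[K] Sym K :=
  AlgEquiv.ofBijective (evalPowerSums K) ⟨evalPowerSums_injective K, evalPowerSums_surjective K⟩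

/-- The plethystic substitution `P ↦ P[X - (1 - 1/q)/z]`, as a Laurent series in `z`: the ring
homomorphism that fixes the constants in `K` and sends `p_r` to `p_r - (1 - q ^ (-r)) z ^ (-r)` for
every `r ≥ 1`. -/
def shift {K : Type} [Field K] [CharZero K] (q : K) : Sym K →+* LaurentSeries (Sym K) :=
  (MvPolynomial.eval₂Hom ((HahnSeries.C : Sym K →+* LaurentSeries (Sym K)).comp
      (algebraMap K (Sym K)))
    fun i : ℕ => HahnSeries.C (p K (i + 1)) -
      HahnSeries.single (-((i : ℤ) + 1)) (algebraMap K (Sym K) (1 - q⁻¹ ^ (i + 1)))).comp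
    (powerSumEquiv K).symm.toRingEquiv.toRingHom

theorem shift_algebraMap {K : Type} [Field K] [CharZero K] (q c : K) :
    shift q (algebraMap K (Sym K) c) = HahnSeries.C (algebraMap K (Sym K) c) := by
  change MvPolynomial.eval₂Hom _ _ ((powerSumEquiv K).symm (algebraMap K (Sym K) c)) = _
  rw [AlgEquiv.commutes, MvPolynomial.algebraMap_eq, MvPolynomial.coe_eval₂Hom,
    MvPolynomial.eval₂_C]
  rfl

theorem shift_p {K : Type} [Field K] [CharZero K] (q : K) (i : ℕ) :
    shift q (p K (i + 1)) = HahnSeries.C (p K (i + 1)) -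
      HahnSeries.single (-((i : ℤ) + 1)) (algebraMap K (Sym K) (1 - q⁻¹ ^ (i + 1))) := by
  have h1 : (powerSumEquiv K).symm (p K (i + 1)) = MvPolynomial.X i := by
    rw [AlgEquiv.symm_apply_eq]
    change _ = evalPowerSums K _
    rw [evalPowerSums, MvPolynomial.aeval_X]
  change MvPolynomial.eval₂Hom _ _ ((powerSumEquiv K).symm (p K (i + 1))) = _
  rw [h1, MvPolynomial.coe_eval₂Hom, MvPolynomial.eval₂_X]

/-- The generating series `∑_{r ≥ 0} z ^ r h_r`, as a Laurent series in `z`. -/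
def H (K : Type) [CommRing K] : LaurentSeries (Sym K) :=
  HahnSeries.ofPowerSeries ℤ (Sym K) (PowerSeries.mk (h K))

/-- The operator `C_a` of Haglund, Morse and Zabrocki: `C_a P` is `(-1/q) ^ (a-1)` times the
coefficient of `z ^ a` in `P[X - (1 - 1/q)/z] ∑_{r ≥ 0} z ^ r h_r`. -/
def opC {K : Type} [Field K] [CharZero K] (q : K) (a : ℕ) : Module.End K (Sym K) where
  toFun P := (-1 / q) ^ ((a : ℤ) - 1) • (shift q P * H K).coeff (a : ℤ)
  map_add' P Q := by
    rw [map_add, add_mul, HahnSeries.coeff_add, smul_add]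
  map_smul' c P := by
    have h1 : shift q (c • P) = HahnSeries.C (algebraMap K (Sym K) c) * shift q P := by
      rw [Algebra.smul_def, map_mul, shift_algebraMap]
    rw [h1, mul_assoc, HahnSeries.C_mul_eq_smul, HahnSeries.coeff_smul, RingHom.id_apply,
      smul_eq_mul, ← Algebra.smul_def, smul_comm]

/-- The composite `C_α = C_{α₁} ∘ ⋯ ∘ C_{α_ℓ}` for a composition `α = (α₁, …, α_ℓ)`; the empty
composition gives the identity. -/
def compC {K : Type} [Field K] [CharZero K] (q : K) {N : ℕ} (α : Composition N) :
    Module.End K (Sym K) :=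
  (α.blocks.map (opC q)).prod

end SymFn

end

/-!
Put `M = n + k`. Multiplying a power sum by an elementary symmetric function gives
`p_r e_k = m_(r, 1^k) + m_(r+1, 1^(k-1))` (`p_mul_e_succ`), so that
`(-1) ^ (n-1) m_(n, 1^k) = (k+1) e_M + Ψ_n(M)` with
`Ψ_n(M) = ∑_{r=1}^{n-1} (e_M - (-1) ^ (r-1) p_r e_{M-r})` (`hookM_eq_newtonSum`, where `Ψ_n(M)` is
`newtonSum K M (n - 1)`).

On the other side, let `T_N` be the sum of `C_τ` over all compositions `τ` of `N`. Comparing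
logarithmic derivatives of generating series shows that `e_m[X - (1 - 1/q)/z]` has a simple form
(`map_eSeries_mul`), and hence that `C_c e_m` is a combination of two hook Schur functions
(`opB_e`). Sums of these telescope: `T_N 1 = e_N` (`sumC_one`), and the two inner sums of the theorem
give `∑_b C_{a+b} T_{k-b} 1 = q ^ (1-a) s_a`, where `s_a = (-1) ^ (a-1) s_(a, 1^k)` (`sum_opC_e`).
It remains to show
`e_M = ∑_a T_{n-a} q ^ (1-a) s_a` and
`Ψ_n(M) = ∑_a (∑_{i=1}^{a-1} q ^ (n-i)) T_{n-a} q ^ (1-a) s_a`.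

Since `T_N = ∑_c C_c T_{N-c}`, such sums are the solutions of recursions that strip off the first
part of a composition (`eq_sum_sumC`). For `e_M` this recursion is the telescoping sum again. For
`Ψ_n(M)` it reads (`newtonSum_recursion`)
`Ψ_n(M) = ∑_{c=1}^{n-1} q ^ c C_c Ψ_{n-c}(M-c) + (1 + q⁻¹ + ⋯ + q ^ (2-n)) s_n`,
and is proved by induction on `n` with `M` fixed. The operator `C_c` acts on `p_r e_m` through
`q ^ c C_c (p_r P) = p_r q ^ c C_c P - (-1) ^ r (1 - q ^ (-r)) q ^ (c+r) C_{c+r} P` (`opB_p_mul`), and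
the sums of products of power sums and hook Schur functions that arise are evaluated by Newton's
identity for the complete homogeneous symmetric functions (`pHookSum_eq`).
-/

noncomputable section

namespace SymFn

/-! ### Power sums, elementary and complete homogeneous symmetric functions -/

section Newton

open MvPowerSeries

/-- The elementary symmetric function `e_k`, as the monomial symmetric function `m_(1^k)`. -/
def e (K : Type) [CommRing K] (k : ℕ) : Sym K := m K (Multiset.replicate k 1)

theorem coeff_m (K : Type) [CommRing K] (μ : Multiset ℕ) (d : ℕ →₀ ℕ) :
    coeff d (m K μ).1 = if parts d = μ then 1 else 0 := by
  change ite _ _ _ = _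
  congr

theorem coeff_h (K : Type) [CommRing K] (r : ℕ) (d : ℕ →₀ ℕ) :
    coeff d (h K r).1 = if d.degree = r then 1 else 0 := rfl

theorem Sym.ext_coeff {K : Type} [CommRing K] {f g : Sym K}
    (hfg : ∀ d : ℕ →₀ ℕ, coeff d f.1 = coeff d g.1) : f = g :=
  Subtype.ext (MvPowerSeries.ext hfg)

theorem parts_eq_zero (d : ℕ →₀ ℕ) : parts d = 0 ↔ d = 0 := by
  simp [parts]

theorem e_zero (K : Type) [CommRing K] : e K 0 = 1 := by
  classical
  refine Sym.ext_coeff fun d => ?_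
  rw [e, coeff_m, OneMemClass.coe_one, coeff_one]
  simp [parts_eq_zero]

theorem h_zero (K : Type) [CommRing K] : h K 0 = 1 := by
  classical
  refine Sym.ext_coeff fun d => ?_
  rw [coeff_h, OneMemClass.coe_one, coeff_one]
  simp only [Finsupp.degree_eq_zero_iff]

/-- Multiplication by `p_{r+1}` removes `x_i ^ (r+1)` from the monomial in every possible way. -/
theorem coeff_p_mul (K : Type) [CommRing K] (r : ℕ) (f : MvPowerSeries ℕ K) (d : ℕ →₀ ℕ) :
    coeff d ((p K (r + 1)).1 * f) =
      ∑ i ∈ d.support with r + 1 ≤ d i, coeff (d - Finsupp.single i (r + 1)) f := by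
  classical
  rw [coeff_mul]
  simp only [p, coeff_m, ite_mul, one_mul, zero_mul]
  rw [← Finset.sum_filter]
  symm
  refine Finset.sum_bij (fun i _ => (Finsupp.single i (r + 1), d - Finsupp.single i (r + 1)))
    ?_ ?_ ?_ ?_
  · intro i hi
    rw [Finset.mem_filter] at hi
    rw [Finset.mem_filter, Finset.HasAntidiagonal.mem_antidiagonal]
    refine ⟨add_tsub_cancel_of_le ?_, (parts_eq_singleton _ _).2 ⟨i, rfl⟩⟩
    rw [Finsupp.single_le_iff]
    exact hi.2
  · intro i _ j _ hij
    exact Finsupp.single_left_injective (by omega) (Prod.ext_iff.1 hij).1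
  · rintro ⟨x, y⟩ hx
    rw [Finset.mem_filter, Finset.HasAntidiagonal.mem_antidiagonal] at hx
    obtain ⟨rfl, hx⟩ := hx
    obtain ⟨i, rfl⟩ := (parts_eq_singleton _ _).1 hx
    refine ⟨i, ?_, ?_⟩
    · simp [Nat.lt_add_right]
    · simp
  · intro i _
    rfl

theorem parts_eq_cons (d : ℕ →₀ ℕ) {i : ℕ} (hi : i ∈ d.support) :
    parts d = d i ::ₘ parts (d.erase i) := by
  classical
  rw [parts, ← Finset.insert_erase hi, Finset.insert_val_of_notMem (Finset.notMem_erase i _),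
    Multiset.map_cons, parts, Finsupp.support_erase]
  congr 1
  refine Multiset.map_congr rfl fun j hj => ?_
  rw [Finsupp.erase_ne (Finset.ne_of_mem_erase hj)]

theorem sub_single_eq_erase (d : ℕ →₀ ℕ) {i r : ℕ} (hi : d i = r) :
    d - Finsupp.single i r = d.erase i := by
  ext j
  rcases eq_or_ne j i with rfl | hj
  · simp [hi]
  · simp [hj, Finsupp.erase_ne hj]

theorem parts_sub_single (d : ℕ →₀ ℕ) {i r : ℕ} (hi : r < d i) :
    parts (d - Finsupp.single i r) = (d i - r) ::ₘ parts (d.erase i) := by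
  have h1 : (d - Finsupp.single i r) i = d i - r := by simp
  rw [parts_eq_cons (d - Finsupp.single i r) (i := i), h1]
  · congr 2
    ext j
    rcases eq_or_ne j i with rfl | hj
    · simp
    · simp [Finsupp.erase_ne hj, hj.symm]
  · rw [Finsupp.mem_support_iff, h1]
    omega

/-- The sum of `x_i ^ r x_{j_1} ⋯ x_{j_k}` over all indices `i` and all `k`-element sets of indices
`j ≠ i`: this is `m_(r, 1^k)` for `r ≥ 2`, and `(k + 1) e_{k+1}` for `r = 1`. The factor is the
number of choices of `i` that give the same monomial. -/
def hookM (K : Type) [CommRing K] (r k : ℕ) : Sym K :=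
  ((r ::ₘ Multiset.replicate k 1).count r : K) • m K (r ::ₘ Multiset.replicate k 1)

theorem hookM_of_two_le (K : Type) [CommRing K] {r : ℕ} (hr : 2 ≤ r) (k : ℕ) :
    hookM K r k = m K (r ::ₘ Multiset.replicate k 1) := by
  rw [hookM, Multiset.count_cons_self, Multiset.count_replicate, if_neg (by omega)]
  simp

theorem hookM_one (K : Type) [CommRing K] (k : ℕ) :
    hookM K 1 k = ((k : K) + 1) • e K (k + 1) := by
  rw [hookM, Multiset.count_cons_self, Multiset.count_replicate, if_pos rfl,
    ← Multiset.replicate_succ, e]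
  push_cast
  rfl

theorem coeff_hookM (K : Type) [CommRing K] (r k : ℕ) (d : ℕ →₀ ℕ) :
    coeff d (hookM K (r + 1) k).1 = ∑ i ∈ d.support,
      if d i = r + 1 ∧ parts (d.erase i) = Multiset.replicate k 1 then 1 else 0 := by
  classical
  have h1 : ∀ i ∈ d.support,
      (if d i = r + 1 ∧ parts (d.erase i) = Multiset.replicate k 1 then (1 : K) else 0) =
      if parts d = (r + 1) ::ₘ Multiset.replicate k 1 then (if d i = r + 1 then 1 else 0)
        else 0 := by
    intro i hi
    rw [parts_eq_cons d hi]
    by_cases h2 : d i = r + 1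
    · simp [h2]
    · simp [h2]
  rw [Finset.sum_congr rfl h1]
  change _ * coeff d (m K _).1 = _
  rw [coeff_m]
  split_ifs with h2
  · rw [mul_one, ← h2, parts, Multiset.count_map, Finset.sum_boole]
    simp only [Finset.card_def, Finset.filter_val, eq_comm]
  · simp

theorem p_mul_e_zero (K : Type) [CommRing K] (r : ℕ) :
    p K (r + 1) * e K 0 = hookM K (r + 1) 0 := by
  rw [e_zero, mul_one, hookM]
  simp [p]

/-- A term `x_i ^ (r+1)` of the power sum meets a squarefree monomial that either avoids `x_i` or
contains it. -/
theorem p_mul_e_succ (K : Type) [CommRing K] (r k : ℕ) :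
    p K (r + 1) * e K (k + 1) = hookM K (r + 1) (k + 1) + hookM K (r + 2) k := by
  classical
  refine Sym.ext_coeff fun d => ?_
  change coeff d ((p K (r + 1)).1 * (e K (k + 1)).1) =
    coeff d ((hookM K (r + 1) (k + 1)).1 + (hookM K (r + 2) k).1)
  rw [coeff_p_mul, map_add, coeff_hookM, coeff_hookM, ← Finset.sum_add_distrib, Finset.sum_filter]
  refine Finset.sum_congr rfl fun i _ => ?_
  rw [e, coeff_m]
  rcases lt_trichotomy (d i) (r + 1) with h1 | h1 | h1
  · rw [if_neg (by omega), if_neg (by omega), if_neg (by omega), add_zero]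
  · rw [if_pos h1.ge, sub_single_eq_erase d h1]
    rw [if_neg (c := d i = r + 2 ∧ _) (by omega), add_zero]
    simp only [h1, true_and]
  · rw [if_pos h1.le, parts_sub_single d h1, if_neg (c := d i = r + 1 ∧ _) (by omega), zero_add]
    congr 1
    rw [eq_iff_iff]
    constructor
    · intro h2
      have h3 : d i - (r + 1) = 1 :=
        Multiset.eq_of_mem_replicate (h2 ▸ Multiset.mem_cons_self _ _)
      rw [h3, Multiset.replicate_succ, Multiset.cons_inj_right] at h2
      exact ⟨by omega, h2⟩
    · rintro ⟨h2, h3⟩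
      rw [h3, h2, Multiset.replicate_succ]
      congr 1
      omega

/-- Repeated use of `p_mul_e_succ`. For `r = 0` this is Newton's identity. -/
theorem hookM_eq_sum (K : Type) [CommRing K] (r k : ℕ) :
    hookM K (r + 1) k = ∑ x ∈ Finset.HasAntidiagonal.antidiagonal k,
      (-1) ^ x.1 * p K (r + x.1 + 1) * e K x.2 := by
  induction k generalizing r with
  | zero => simp [← p_mul_e_zero]
  | succ k ih =>
    rw [Finset.Nat.antidiagonal_succ, Finset.sum_cons, Finset.sum_map,
      eq_sub_of_add_eq (p_mul_e_succ K r k).symm, ih (r + 1), sub_eq_add_neg,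
      ← Finset.sum_neg_distrib]
    congr 1
    · simp
    · refine Finset.sum_congr rfl fun x _ => ?_
      have h1 : r + 1 + x.1 + 1 = r + (x.1 + 1) + 1 := by ring
      simp only [Function.Embedding.coe_prodMap, Function.Embedding.coeFn_mk, Prod.map_fst,
        Prod.map_snd, Function.Embedding.refl_apply, h1, pow_succ, Nat.succ_eq_add_one]
      ring

/-- Newton's identity for the elementary symmetric functions. -/
theorem newton_e (K : Type) [CommRing K] (n : ℕ) :
    ((n : Sym K) + 1) * e K (n + 1) = ∑ x ∈ Finset.HasAntidiagonal.antidiagonal n,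
      (-1) ^ x.1 * p K (x.1 + 1) * e K x.2 := by
  have h1 := hookM_eq_sum K 0 n
  rw [zero_add, hookM_one, Algebra.smul_def] at h1
  simpa using h1

/-- Newton's identity for the complete homogeneous symmetric functions. -/
theorem newton_h (K : Type) [CommRing K] (n : ℕ) :
    ((n : Sym K) + 1) * h K (n + 1) = ∑ x ∈ Finset.HasAntidiagonal.antidiagonal n,
      p K (x.1 + 1) * h K x.2 := by
  classical
  have h0 : ((n : Sym K) + 1) = algebraMap K (Sym K) ((n : K) + 1) := by simp
  rw [h0, ← Algebra.smul_def]
  refine Sym.ext_coeff fun d => ?_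
  have h1 : (∑ x ∈ Finset.HasAntidiagonal.antidiagonal n, p K (x.1 + 1) * h K x.2).1 =
      ∑ x ∈ Finset.HasAntidiagonal.antidiagonal n, (p K (x.1 + 1)).1 * (h K x.2).1 := by
    rw [AddSubmonoidClass.coe_finsetSum]
    rfl
  rw [h1, map_sum]
  change ((n : K) + 1) * coeff d (h K (n + 1)).1 = _
  simp only [coeff_p_mul, coeff_h]
  have h2 : ∀ x ∈ Finset.HasAntidiagonal.antidiagonal n,
      (∑ i ∈ d.support with x.1 + 1 ≤ d i,
        if (d - Finsupp.single i (x.1 + 1)).degree = x.2 then (1 : K) else 0) =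
      ∑ i ∈ d.support, if d.degree = n + 1 then (if x.1 + 1 ≤ d i then 1 else 0) else 0 := by
    intro x hx
    rw [Finset.HasAntidiagonal.mem_antidiagonal] at hx
    rw [Finset.sum_filter]
    refine Finset.sum_congr rfl fun i _ => ?_
    by_cases h3 : x.1 + 1 ≤ d i
    · have h4 : d.degree = (d - Finsupp.single i (x.1 + 1)).degree + (x.1 + 1) := by
        conv_lhs => rw [← tsub_add_cancel_of_le (Finsupp.single_le_iff.2 h3)]
        rw [map_add, Finsupp.degree_single]
      rw [if_pos h3, if_pos h3]
      congr 1
      rw [eq_iff_iff]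
      omega
    · simp [h3]
  rw [Finset.sum_congr rfl h2]
  -- The number of pairs `(i, r)` with `1 ≤ r ≤ d i` is the degree of `d`.
  by_cases h5 : d.degree = n + 1
  · simp only [h5, if_true, mul_one]
    rw [Finset.sum_comm]
    have h6 : ∀ i ∈ d.support, (∑ x ∈ Finset.HasAntidiagonal.antidiagonal n,
        if x.1 + 1 ≤ d i then (1 : K) else 0) = (d i : K) := by
      intro i _
      rw [Finset.Nat.sum_antidiagonal_eq_sum_range_succ_mk, Finset.sum_boole]
      congr 1
      have h7 : d i ≤ n + 1 := h5 ▸ Finsupp.le_degree i d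
      have h8 : (Finset.range (n + 1)).filter (fun j => j + 1 ≤ d i) = Finset.range (d i) := by
        ext j
        simp only [Finset.mem_filter, Finset.mem_range]
        omega
      simp only [Nat.succ_eq_add_one]
      rw [h8, Finset.card_range]
    rw [Finset.sum_congr rfl h6, ← Nat.cast_sum, ← Finsupp.degree_apply, h5]
    push_cast
    rfl
  · simp [h5]

end Newton

/-! ### Generating series and the substitution on elementary symmetric functions -/

section LogDerivative

open PowerSeries

/-- The generating series `∑ e_k X ^ k`. -/
def eSeries (K : Type) [CommRing K] : PowerSeries (Sym K) := PowerSeries.mk (e K)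

/-- The generating series `∑ h_k (-X) ^ k`. -/
def hSeries (K : Type) [CommRing K] : PowerSeries (Sym K) :=
  PowerSeries.mk fun j => (-1) ^ j * h K j

/-- The generating series `∑ p_{r+1} (-X) ^ r`, the logarithmic derivative of `∑ e_k X ^ k`. -/
def pSeries (K : Type) [CommRing K] : PowerSeries (Sym K) :=
  PowerSeries.mk fun r => (-1) ^ r * p K (r + 1)

theorem derivative_eSeries (K : Type) [CommRing K] :
    d⁄dX (Sym K) (eSeries K) = pSeries K * eSeries K := by
  refine PowerSeries.ext fun n => ?_
  rw [PowerSeries.coeff_derivative, PowerSeries.coeff_mul, eSeries, pSeries, PowerSeries.coeff_mk,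
    mul_comm, newton_e]
  simp

theorem derivative_hSeries (K : Type) [CommRing K] :
    d⁄dX (Sym K) (hSeries K) = -(pSeries K * hSeries K) := by
  refine PowerSeries.ext fun n => ?_
  rw [PowerSeries.coeff_derivative, map_neg, PowerSeries.coeff_mul, hSeries, pSeries,
    PowerSeries.coeff_mk, mul_assoc, mul_comm (h K (n + 1)), newton_h, Finset.mul_sum,
    ← Finset.sum_neg_distrib]
  refine Finset.sum_congr rfl fun x hx => ?_
  rw [Finset.HasAntidiagonal.mem_antidiagonal] at hx
  rw [PowerSeries.coeff_mk, PowerSeries.coeff_mk, ← hx]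
  ring

instance (K : Type) [Field K] [CharZero K] : IsAddTorsionFree (Sym K) :=
  .of_isTorsionFree K _

instance (K : Type) [Field K] [CharZero K] : IsAddTorsionFree (LaurentSeries (Sym K)) where
  nsmul_right_injective n hn f g hfg := by
    ext1
    funext a
    have h1 := congrArg (fun x : LaurentSeries (Sym K) => x.coeff a) hfg
    simp only [HahnSeries.coeff_nsmul, Pi.smul_apply] at h1
    exact nsmul_right_injective hn h1

/-- The two logarithmic derivatives are opposite, so the product is constant. -/
theorem eSeries_mul_hSeries (K : Type) [Field K] [CharZero K] : eSeries K * hSeries K = 1 := by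
  refine PowerSeries.derivative.ext ?_ ?_
  · rw [Derivation.leibniz, derivative_eSeries, derivative_hSeries, smul_eq_mul, smul_eq_mul,
      PowerSeries.derivative_one]
    ring
  · rw [map_mul, ← PowerSeries.coeff_zero_eq_constantCoeff_apply,
      ← PowerSeries.coeff_zero_eq_constantCoeff_apply, eSeries, hSeries, PowerSeries.coeff_mk,
      PowerSeries.coeff_mk, e_zero, h_zero]
    simp

/-- The geometric series `∑ (-a X) ^ j`. -/
def geomSeries {R : Type} [CommRing R] (a : R) : PowerSeries R := PowerSeries.mk fun j => (-a) ^ j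

theorem geomSeries_mul {R : Type} [CommRing R] (a : R) :
    geomSeries a * (1 + C a * X) = 1 := by
  refine PowerSeries.ext fun n => ?_
  rw [mul_add, mul_one, map_add, ← mul_assoc]
  cases n with
  | zero => simp [geomSeries]
  | succ n =>
    rw [PowerSeries.coeff_succ_mul_X, PowerSeries.coeff_mul_C, geomSeries, PowerSeries.coeff_mk,
      PowerSeries.coeff_mk, PowerSeries.coeff_one, if_neg (by omega)]
    ring

theorem derivative_one_add {R : Type} [CommRing R] (a : R) :
    d⁄dX R (1 + C a * X) = C a := by
  rw [map_add, Derivation.leibniz, PowerSeries.derivative_one, PowerSeries.derivative_C,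
    PowerSeries.derivative_X]
  simp

theorem derivative_geomSeries {R : Type} [CommRing R] (a : R) :
    d⁄dX R (geomSeries a) = -(C a * geomSeries a * geomSeries a) := by
  have h1 := congrArg (d⁄dX R) (geomSeries_mul a)
  rw [Derivation.leibniz, derivative_one_add, PowerSeries.derivative_one, smul_eq_mul,
    smul_eq_mul] at h1
  linear_combination geomSeries a * h1 - d⁄dX R (geomSeries a) * geomSeries_mul a

theorem derivative_map {R S : Type} [CommRing R] [CommRing S] (φ : R →+* S) (f : PowerSeries R) :
    d⁄dX S (PowerSeries.map φ f) = PowerSeries.map φ (d⁄dX R f) := by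
  refine PowerSeries.ext fun n => ?_
  simp [PowerSeries.coeff_derivative]

/-- Two substitutions `φ` and `ψ` that differ on the power sums by `p_r ↦ p_r - w ^ r + a ^ r` turn
`E(X) = ∑ e_k X ^ k` into series whose quotient is `(1 + a X) / (1 + w X)`: both have the same
logarithmic derivative. -/
theorem map_eSeries_mul {K L : Type} [Field K] [CharZero K] [CommRing L] [IsAddTorsionFree L]
    (φ ψ : Sym K →+* L) (w a : L)
    (hp : ∀ i, φ (p K (i + 1)) = ψ (p K (i + 1)) - w ^ (i + 1) + a ^ (i + 1)) :
    PowerSeries.map φ (eSeries K) * (1 + C w * X) =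
      PowerSeries.map ψ (eSeries K) * (1 + C a * X) := by
  have hBB : PowerSeries.map ψ (eSeries K) * PowerSeries.map ψ (hSeries K) = 1 := by
    rw [← map_mul, eSeries_mul_hSeries, map_one]
  have hlog : PowerSeries.map φ (pSeries K) + C w * geomSeries w =
      PowerSeries.map ψ (pSeries K) + C a * geomSeries a := by
    refine PowerSeries.ext fun r => ?_
    rw [map_add, map_add, PowerSeries.coeff_map, PowerSeries.coeff_map, PowerSeries.coeff_C_mul,
      PowerSeries.coeff_C_mul, pSeries, geomSeries, geomSeries, PowerSeries.coeff_mk,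
      PowerSeries.coeff_mk, PowerSeries.coeff_mk, map_mul, map_mul, hp, map_pow, map_neg,
      map_one, map_pow, map_neg, map_one, neg_pow w, neg_pow a]
    ring
  have hA : d⁄dX _ (PowerSeries.map φ (eSeries K)) =
      PowerSeries.map φ (pSeries K) * PowerSeries.map φ (eSeries K) := by
    rw [derivative_map, derivative_eSeries, map_mul]
  have hB : d⁄dX _ (PowerSeries.map ψ (hSeries K)) =
      -(PowerSeries.map ψ (pSeries K) * PowerSeries.map ψ (hSeries K)) := by
    rw [derivative_map, derivative_hSeries, map_neg, map_mul]
  have h0A : constantCoeff (PowerSeries.map φ (eSeries K)) = 1 := by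
    simp [← PowerSeries.coeff_zero_eq_constantCoeff_apply, -coeff_zero_eq_constantCoeff, eSeries,
      e_zero]
  have h0B : constantCoeff (PowerSeries.map ψ (hSeries K)) = 1 := by
    simp [← PowerSeries.coeff_zero_eq_constantCoeff_apply, -coeff_zero_eq_constantCoeff, hSeries,
      h_zero]
  have h0G : constantCoeff (geomSeries a) = 1 := by
    simp [← PowerSeries.coeff_zero_eq_constantCoeff_apply, -coeff_zero_eq_constantCoeff, geomSeries]
  generalize PowerSeries.map φ (eSeries K) = A at *
  generalize PowerSeries.map ψ (eSeries K) = B at *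
  generalize PowerSeries.map ψ (hSeries K) = B' at *
  have key : A * (1 + C w * X) * (B' * geomSeries a) = 1 := by
    refine PowerSeries.derivative.ext ?_ ?_
    · rw [Derivation.leibniz, Derivation.leibniz, Derivation.leibniz, hA, hB,
        derivative_one_add, derivative_geomSeries, PowerSeries.derivative_one]
      simp only [smul_eq_mul]
      linear_combination A * (1 + C w * X) * B' * geomSeries a * hlog -
        A * B' * geomSeries a * C w * geomSeries_mul w
    · simp [h0A, h0B, h0G]
  linear_combination B * (1 + C a * X) * key - A * (1 + C w * X) * hBB -
    A * (1 + C w * X) * B * B' * geomSeries_mul a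

/-- The coefficients of `map_eSeries_mul`. -/
theorem map_e_succ {K L : Type} [Field K] [CharZero K] [CommRing L] [IsAddTorsionFree L]
    (φ ψ : Sym K →+* L) (w a : L)
    (hp : ∀ i, φ (p K (i + 1)) = ψ (p K (i + 1)) - w ^ (i + 1) + a ^ (i + 1)) (k : ℕ) :
    φ (e K (k + 1)) + w * φ (e K k) = ψ (e K (k + 1)) + a * ψ (e K k) := by
  have h1 := congrArg (PowerSeries.coeff (k + 1)) (map_eSeries_mul φ ψ w a hp)
  rw [mul_add, mul_add, mul_one, mul_one, ← mul_assoc, ← mul_assoc, map_add, map_add,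
    PowerSeries.coeff_succ_mul_X, PowerSeries.coeff_succ_mul_X, PowerSeries.coeff_mul_C,
    PowerSeries.coeff_mul_C] at h1
  simp only [PowerSeries.coeff_map, eSeries, PowerSeries.coeff_mk] at h1
  linear_combination h1

end LogDerivative

/-! ### The operators on power sums and elementary symmetric functions -/

section Operator

/-- The inverse `w = 1/z` of the variable of Laurent series. -/
def invZ (K : Type) [CommRing K] : LaurentSeries (Sym K) := HahnSeries.single (-1) 1

/-- A scalar, as a Laurent series. -/
def scal {K : Type} [CommRing K] (c : K) : LaurentSeries (Sym K) :=
  HahnSeries.C (algebraMap K (Sym K) c)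

variable {K : Type} [Field K] [CharZero K] (q : K)

theorem shift_p_eq (i : ℕ) :
    shift q (p K (i + 1)) =
      HahnSeries.C (p K (i + 1)) - invZ K ^ (i + 1) + (scal q⁻¹ * invZ K) ^ (i + 1) := by
  have h1 : (i + 1) • (-1 : ℤ) = -((i : ℤ) + 1) := by simp
  rw [shift_p, mul_pow, scal, ← map_pow, ← map_pow, invZ, HahnSeries.single_pow,
    HahnSeries.C_mul_eq_smul, one_pow, map_sub, map_one, h1]
  ext1
  funext n
  simp only [HahnSeries.coeff_sub, HahnSeries.coeff_add, HahnSeries.coeff_smul,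
    HahnSeries.coeff_single]
  split_ifs
  · rw [smul_eq_mul, mul_one, sub_add]
  · rw [smul_eq_mul, mul_zero, add_zero]

/-- The case of the plethystic substitution, with `w = 1/z` and `a = 1/(qz)`. -/
theorem shift_e_succ (k : ℕ) :
    shift q (e K (k + 1)) + invZ K * shift q (e K k) =
      HahnSeries.C (e K (k + 1)) + scal q⁻¹ * (invZ K * HahnSeries.C (e K k)) := by
  rw [← mul_assoc]
  exact map_e_succ (L := LaurentSeries (Sym K)) (shift q) HahnSeries.C (invZ K)
    (scal q⁻¹ * invZ K) (shift_p_eq q) k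

/-- The coefficient of `z ^ c` in `P[X - (1 - 1/q)/z] ∑ z ^ r h_r`. -/
def opD (c : ℕ) (P : Sym K) : Sym K := (shift q P * H K).coeff (c : ℤ)

omit [CharZero K] in
theorem coeff_H (c : ℕ) : (H K).coeff (c : ℤ) = h K c := by
  have h1 := HahnSeries.ofPowerSeries_apply_coeff (Γ := ℤ) (PowerSeries.mk (h K)) c
  rw [PowerSeries.coeff_mk] at h1
  exact h1

omit [CharZero K] in
theorem coeff_invZ_pow_mul (f : LaurentSeries (Sym K)) (c r : ℕ) :
    (invZ K ^ r * f).coeff (c : ℤ) = f.coeff ((c + r : ℕ) : ℤ) := by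
  rw [invZ, HahnSeries.single_pow, HahnSeries.coeff_single_mul, one_pow, one_mul]
  congr 1
  simp

omit [CharZero K] in
theorem coeff_invZ_mul (f : LaurentSeries (Sym K)) (c : ℕ) :
    (invZ K * f).coeff (c : ℤ) = f.coeff ((c + 1 : ℕ) : ℤ) := by
  rw [← coeff_invZ_pow_mul, pow_one]

omit [CharZero K] in
theorem coeff_C_mul' (x : Sym K) (f : LaurentSeries (Sym K)) (c : ℤ) :
    (HahnSeries.C x * f).coeff c = x * f.coeff c := by
  rw [HahnSeries.C_mul_eq_smul, HahnSeries.coeff_smul, smul_eq_mul]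

theorem opD_one (c : ℕ) : opD q c 1 = h K c := by
  rw [opD, map_one, one_mul, coeff_H]

/-- The substitution is multiplicative, and multiplication by `z ^ (-r)` moves the coefficient of
`z ^ (c + r)` to that of `z ^ c`. -/
theorem opD_p_mul (c r : ℕ) (P : Sym K) :
    opD q c (p K (r + 1) * P) = p K (r + 1) * opD q c P -
      algebraMap K (Sym K) (1 - q⁻¹ ^ (r + 1)) * opD q (c + (r + 1)) P := by
  have h1 : shift q (p K (r + 1) * P) * H K =
      HahnSeries.C (p K (r + 1)) * (shift q P * H K) -
        HahnSeries.C (algebraMap K (Sym K) (1 - q⁻¹ ^ (r + 1))) *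
          (invZ K ^ (r + 1) * (shift q P * H K)) := by
    rw [map_mul, shift_p_eq, mul_pow, scal, ← map_pow, ← map_pow, map_sub (algebraMap K (Sym K)),
      map_sub, map_one, map_one]
    ring
  rw [opD, h1, HahnSeries.coeff_sub, coeff_C_mul', coeff_C_mul', coeff_invZ_pow_mul]
  rfl

theorem opD_e_succ (c k : ℕ) :
    opD q c (e K (k + 1)) + opD q (c + 1) (e K k) =
      e K (k + 1) * h K c + algebraMap K (Sym K) q⁻¹ * (e K k * h K (c + 1)) := by
  have h1 := congrArg (fun f => (f * H K).coeff (c : ℤ)) (shift_e_succ q k)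
  simp only [add_mul, HahnSeries.coeff_add, mul_assoc, coeff_invZ_mul, coeff_C_mul', coeff_H,
    scal] at h1
  exact h1

end Operator

/-! ### Sums over compositions -/

section Compositions

/-- The sum of `C_τ` over all compositions `τ` of `N`. -/
def sumC {K : Type} [Field K] [CharZero K] (q : K) (N : ℕ) : Module.End K (Sym K) :=
  ∑ τ : Composition N, compC q τ

/-- A composition of `N + 1` is a first part `c + 1` and a composition of the rest. -/
def compositionSuccEquiv (N : ℕ) :
    Composition (N + 1) ≃ Σ c : Fin (N + 1), Composition (N - c) where
  toFun τ :=
    ⟨⟨τ.blocks.headI - 1, by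
      have h1 := τ.blocks_sum
      cases h2 : τ.blocks with
      | nil => simp
      | cons b l =>
        rw [h2, List.sum_cons] at h1
        simp
        omega⟩,
      ⟨τ.blocks.tail, fun hi => τ.blocks_pos (List.mem_of_mem_tail hi), by
        have h1 := τ.blocks_sum
        change τ.blocks.tail.sum = N - (τ.blocks.headI - 1)
        cases h2 : τ.blocks with
        | nil => simp [h2] at h1
        | cons b l =>
          have h3 : 0 < b := τ.blocks_pos (by simp [h2])
          rw [h2, List.sum_cons] at h1
          simp
          omega⟩⟩
  invFun x :=
    ⟨(x.1 + 1) :: x.2.blocks, fun hi => by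
      rcases List.mem_cons.1 hi with rfl | hi
      · omega
      · exact x.2.blocks_pos hi, by
      rw [List.sum_cons, x.2.blocks_sum]
      omega⟩
  left_inv τ := by
    ext1
    have h1 := τ.blocks_sum
    cases h2 : τ.blocks with
    | nil => simp [h2] at h1
    | cons b l =>
      have h3 : 0 < b := τ.blocks_pos (by simp [h2])
      simp [h2]
      omega
  right_inv x := rfl

variable {K : Type} [Field K] [CharZero K] (q : K)

theorem sumC_zero : sumC q 0 = 1 := by
  have h1 : ∀ τ : Composition 0, compC q τ = 1 := fun τ => by
    rw [compC, τ.blocks_eq_nil.2 rfl]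
    rfl
  rw [sumC, Finset.sum_congr rfl fun τ _ => h1 τ]
  simp [composition_card]

/-- Stripping off the first part of the composition. -/
theorem sumC_succ (N : ℕ) :
    sumC q (N + 1) = ∑ c ∈ Finset.range (N + 1), opC q (c + 1) * sumC q (N - c) := by
  rw [sumC, ← (compositionSuccEquiv N).symm.sum_comp, Fintype.sum_sigma, Finset.sum_range]
  refine Finset.sum_congr rfl fun c _ => ?_
  rw [sumC, Finset.mul_sum]
  refine Finset.sum_congr rfl fun τ _ => ?_
  rfl

end Compositions

/-! ### Hook Schur functions -/

variable {K : Type}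

/-- The hook Schur function `s_(a, 1^m)` for `a ≥ 1`, by the Pieri recursion
`s_(a, 1^m) = e_m h_a - s_(a+1, 1^(m-1))`. The value at `a = 0` is `0` for `m ≥ 1`, and `1` for
`m = 0`. -/
def hook (K : Type) [CommRing K] : ℕ → ℕ → Sym K
  | a, 0 => h K a
  | a, m + 1 => e K (m + 1) * h K a - hook K (a + 1) m

theorem neg_one_pow_mul_self {R : Type} [CommRing R] (n : ℕ) : ((-1) ^ n * (-1) ^ n : R) = 1 := by
  rw [← mul_pow]
  simp

theorem hook_eq_sum (K : Type) [CommRing K] (a m : ℕ) :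
    hook K a m = ∑ x ∈ Finset.HasAntidiagonal.antidiagonal m,
      e K x.1 * ((-1) ^ x.2 * h K (a + x.2)) := by
  induction m generalizing a with
  | zero => simp [hook, e_zero]
  | succ m ih =>
    rw [hook, Finset.Nat.antidiagonal_succ', Finset.sum_cons, Finset.sum_map, ih, sub_eq_add_neg,
      ← Finset.sum_neg_distrib]
    congr 1
    · simp
    · refine Finset.sum_congr rfl fun x _ => ?_
      have h1 : a + 1 + x.2 = a + (x.2 + 1) := by ring
      simp only [Function.Embedding.coe_prodMap, Function.Embedding.coeFn_mk, Prod.map_fst,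
        Prod.map_snd, Function.Embedding.refl_apply, h1, pow_succ, Nat.succ_eq_add_one]
      ring

/-- The Pieri recursion at `a = 0`, where the alternating sum vanishes. -/
theorem hook_one (K : Type) [Field K] [CharZero K] (m : ℕ) : hook K 1 m = e K (m + 1) := by
  have h1 := congrArg (PowerSeries.coeff (m + 1)) (eSeries_mul_hSeries K)
  rw [PowerSeries.coeff_mul, PowerSeries.coeff_one, if_neg (by omega)] at h1
  have h2 : hook K 0 (m + 1) = 0 := by
    rw [hook_eq_sum, ← h1]
    simp [eSeries, hSeries]
  rw [hook, h_zero, mul_one] at h2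
  exact (sub_eq_zero.1 h2).symm

/-- The signed hook Schur function `(-1) ^ (a-1) s_(a, 1^(M-a))` of degree `M`, taken to be `0` for
`a > M`, so that differences of neighbours are uniform up to `a = M` (`sg_sub`). -/
def sg (K : Type) [CommRing K] (M a : ℕ) : Sym K :=
  if a ≤ M then (-1) ^ (a + 1) * hook K a (M - a) else 0

theorem sg_one (K : Type) [Field K] [CharZero K] (M : ℕ) : sg K (M + 1) 1 = e K (M + 1) := by
  rw [sg, if_pos (by omega), Nat.add_sub_cancel, hook_one]
  ring

theorem sg_sub (K : Type) [CommRing K] {M c : ℕ} (hc : c ≤ M) :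
    sg K M c - sg K M (c + 1) = (-1) ^ (c + 1) * (e K (M - c) * h K c) := by
  obtain ⟨m, rfl⟩ := Nat.exists_eq_add_of_le hc
  rw [sg, sg, if_pos hc, Nat.add_sub_cancel_left]
  cases m with
  | zero => rw [if_neg (by omega), hook, e_zero]; ring
  | succ m =>
    have h1 : c + (m + 1) - (c + 1) = m := by omega
    rw [if_pos (by omega), hook, h1]
    ring

variable [Field K] [CharZero K] (q : K)

/-- `q D_c e_m = q s_(c, 1^m) + s_(c+1, 1^(m-1))`. -/
theorem opD_e {c m : ℕ} (hq : q ≠ 0) :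
    algebraMap K (Sym K) q * opD q c (e K m) =
      algebraMap K (Sym K) q * hook K c m +
        (if m = 0 then 0 else hook K (c + 1) (m - 1)) := by
  have hqq : algebraMap K (Sym K) q * algebraMap K (Sym K) q⁻¹ = 1 := by
    rw [← map_mul, mul_inv_cancel₀ hq, map_one]
  induction m generalizing c with
  | zero => rw [e_zero, opD_one, if_pos rfl, hook, add_zero]
  | succ m ih =>
    rw [eq_sub_of_add_eq (opD_e_succ q c m), mul_sub, ih, if_neg (Nat.succ_ne_zero m), hook,
      Nat.add_sub_cancel]
    cases m with
    | zero =>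
      rw [if_pos rfl, hook, e_zero]
      linear_combination h K (c + 1) * hqq
    | succ m =>
      rw [if_neg (Nat.succ_ne_zero m), Nat.add_sub_cancel]
      have h1 : hook K (c + 1) (m + 1) = e K (m + 1) * h K (c + 1) - hook K (c + 1 + 1) m := rfl
      linear_combination e K (m + 1) * h K (c + 1) * hqq - h1

/-- The rescaled operator `q ^ c C_c`. -/
def opB (c : ℕ) : Sym K →ₗ[K] Sym K := q ^ c • opC q c

theorem opB_apply (c : ℕ) (P : Sym K) : opB q c P = q ^ c • opC q c P := rfl

theorem opB_eq (hq : q ≠ 0) (c : ℕ) (P : Sym K) :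
    opB q c P = (-1) ^ (c + 1) * (algebraMap K (Sym K) q * opD q c P) := by
  have h1 : q ^ c * (-1 / q) ^ ((c : ℤ) - 1) = (-1) ^ (c + 1) * q := by
    rw [zpow_sub_one₀ (div_ne_zero (by simp) hq), zpow_natCast, div_pow]
    field_simp
    ring
  have h2 : opB q c P = q ^ c • ((-1 / q) ^ ((c : ℤ) - 1) • opD q c P) := rfl
  rw [h2, smul_smul, h1, Algebra.smul_def]
  simp
  ring

theorem opC_eq_opB (hq : q ≠ 0) (c : ℕ) (P : Sym K) : opC q c P = q⁻¹ ^ c • opB q c P := by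
  rw [opB_apply, smul_smul, ← mul_pow, inv_mul_cancel₀ hq, one_pow, one_smul]

theorem opB_e (hq : q ≠ 0) {M c : ℕ} (hc : c ≤ M) :
    opB q c (e K (M - c)) = algebraMap K (Sym K) q * sg K M c - sg K M (c + 1) := by
  rw [opB_eq q hq, opD_e q hq, sg, sg, if_pos hc]
  by_cases h1 : M - c = 0
  · rw [if_pos h1, if_neg (by omega)]
    ring
  · rw [if_neg h1, if_pos (by omega), Nat.sub_sub]
    ring

theorem opB_p_mul (hq : q ≠ 0) (c r : ℕ) (P : Sym K) :
    opB q c (p K (r + 1) * P) = p K (r + 1) * opB q c P -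
      (-1) ^ (r + 1) * (algebraMap K (Sym K) (1 - q⁻¹ ^ (r + 1)) * opB q (c + (r + 1)) P) := by
  have h1 : ((-1) ^ (r + 1) * (-1) ^ (r + 1) : Sym K) = 1 :=
    neg_one_pow_mul_self _
  rw [opB_eq q hq, opB_eq q hq, opB_eq q hq, opD_p_mul, add_right_comm c (r + 1) 1, pow_add]
  linear_combination (-1) ^ (c + 1) * algebraMap K (Sym K) q *
    algebraMap K (Sym K) (1 - q⁻¹ ^ (r + 1)) * opD q (c + (r + 1)) P * h1

/-- By `opB_e` the sum telescopes to a multiple of a hook Schur function. -/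
theorem sum_opC_e (hq : q ≠ 0) (a k : ℕ) :
    ∑ b ∈ Finset.range (k + 1), opC q (a + 1 + b) (e K (k - b)) =
      q⁻¹ ^ a • sg K (a + 1 + k) (a + 1) := by
  have h1 : ∀ b ∈ Finset.range (k + 1), opC q (a + 1 + b) (e K (k - b)) =
      q⁻¹ ^ (a + b) • sg K (a + 1 + k) (a + 1 + b) -
        q⁻¹ ^ (a + (b + 1)) • sg K (a + 1 + k) (a + 1 + (b + 1)) := by
    intro b hb
    rw [Finset.mem_range] at hb
    have h2 : k - b = a + 1 + k - (a + 1 + b) := by omega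
    have h3 : q⁻¹ ^ (a + 1 + b) * q = q⁻¹ ^ (a + b) := by
      rw [add_right_comm, pow_succ, mul_assoc, inv_mul_cancel₀ hq, mul_one]
    rw [opC_eq_opB q hq, h2, opB_e q hq (by omega), smul_sub, ← Algebra.smul_def, smul_smul, h3,
      (by ring : a + (b + 1) = a + 1 + b)]
    rfl
  rw [Finset.sum_congr rfl h1,
    Finset.sum_range_sub' (fun b => q⁻¹ ^ (a + b) • sg K (a + 1 + k) (a + 1 + b))]
  have h4 : sg K (a + 1 + k) (a + 1 + (k + 1)) = 0 := if_neg (by omega)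
  rw [h4, smul_zero, sub_zero, add_zero, add_zero]

/-- The case of a hook with a single column. -/
theorem sum_opC_e_eq_e (hq : q ≠ 0) (N : ℕ) :
    ∑ c ∈ Finset.range (N + 1), opC q (c + 1) (e K (N - c)) = e K (N + 1) := by
  have h1 := sum_opC_e q hq 0 N
  rw [pow_zero, one_smul, zero_add, add_comm 1 N, sg_one] at h1
  rw [← h1]
  refine Finset.sum_congr rfl fun c _ => ?_
  rw [add_comm c 1]

theorem sumC_one (hq : q ≠ 0) (N : ℕ) : sumC q N 1 = e K N := by
  induction N using Nat.strong_induction_on with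
  | _ N ih =>
    cases N with
    | zero => rw [sumC_zero, e_zero]; rfl
    | succ N =>
      rw [sumC_succ, LinearMap.sum_apply, ← sum_opC_e_eq_e q hq]
      refine Finset.sum_congr rfl fun c _ => ?_
      rw [Module.End.mul_apply, ih _ (by omega)]

/-! ### A recursion for sums of products of power sums and elementary symmetric functions -/

section Recursion

/-- The sum over `1 ≤ c ≤ n` of `(-1) ^ r p_r`, where `r = n + 1 - c`, times the signed hook Schur
function of degree `M - r` with first row `c`. The summation index is `c - 1`. -/
def pHookSum (K : Type) [CommRing K] (M n : ℕ) : Sym K :=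
  ∑ c ∈ Finset.range n, (-1) ^ (n - c) * p K (n - c) * sg K (M - n + c) (c + 1)

theorem pHookSum_succ (K : Type) [Field K] [CharZero K] {M n : ℕ} (hn : n + 2 ≤ M) :
    pHookSum K M (n + 1) =
      ∑ c ∈ Finset.range n, (-1) ^ (n - c) * p K (n - c) * sg K (M - n + c) (c + 2) +
        (-1) ^ (n + 1) * p K (n + 1) * e K (M - (n + 1)) := by
  rw [pHookSum, Finset.sum_range_succ']
  congr 1
  · refine Finset.sum_congr rfl fun c hc => ?_
    rw [Nat.add_sub_add_right]
    congr 2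
    omega
  · obtain ⟨m, hm⟩ : ∃ m, M - (n + 1) = m + 1 := ⟨M - n - 2, by omega⟩
    simp [hm, sg_one]

/-- The terms of the two sums that contain the same power sum differ by a multiple of
`p_r h_{n+1-r}`, so that Newton's identity for the complete homogeneous symmetric functions gives
the difference. -/
theorem pHookSum_sub (K : Type) [Field K] [CharZero K] {M n : ℕ} (hn : n + 2 ≤ M) :
    pHookSum K M (n + 1) - pHookSum K M n =
      -(((n : Sym K) + 1) * (sg K M (n + 1) - sg K M (n + 2))) := by
  have h1 := newton_h K n
  rw [← Finset.Nat.sum_antidiagonal_swap, Finset.Nat.sum_antidiagonal_eq_sum_range_succ_mk,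
    Finset.sum_range_succ'] at h1
  simp only [Prod.swap, h_zero, Nat.sub_zero, mul_one] at h1
  have h2 : ∀ c ∈ Finset.range n,
      (-1) ^ (n - c) * p K (n - c) * sg K (M - n + c) (c + 2) -
        (-1) ^ (n - c) * p K (n - c) * sg K (M - n + c) (c + 1) =
      (-1) ^ (n + 1) * e K (M - (n + 1)) * (p K (n - (c + 1) + 1) * h K (c + 1)) := by
    intro c hc
    rw [Finset.mem_range] at hc
    have h3 := sg_sub K (M := M - n + c) (c := c + 1) (by omega)
    have h4 : M - n + c - (c + 1) = M - (n + 1) := by omega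
    have h5 : n - (c + 1) + 1 = n - c := by omega
    have h6 : ((-1) ^ (n + 1) : Sym K) = (-1) ^ (n - c) * (-1) ^ (c + 1) := by
      rw [← pow_add]
      congr 1
      omega
    rw [h4] at h3
    rw [h5, h6]
    linear_combination -(-1) ^ (n - c) * p K (n - c) * h3
  rw [pHookSum_succ K hn, pHookSum, add_sub_right_comm, ← Finset.sum_sub_distrib,
    Finset.sum_congr rfl h2, ← Finset.mul_sum, sg_sub K (by omega : n + 1 ≤ M)]
  linear_combination -(-1) ^ (n + 1) * e K (M - (n + 1)) * h1

theorem pHookSum_eq (K : Type) [Field K] [CharZero K] {M n : ℕ} (hn : n + 1 ≤ M) :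
    pHookSum K M n =
      ((n : Sym K) + 1) * sg K M (n + 1) - ∑ c ∈ Finset.range (n + 1), sg K M (c + 1) := by
  induction n with
  | zero => simp [pHookSum]
  | succ n ih =>
    rw [Finset.sum_range_succ]
    have h1 := pHookSum_sub K hn
    have h2 := ih (by omega)
    push_cast
    linear_combination h1 + h2

/-- The symmetric function `∑_{r = 1}^n (e_M - (-1) ^ (r-1) p_r e_{M-r})`. -/
def newtonSum (K : Type) [CommRing K] (M n : ℕ) : Sym K :=
  ∑ r ∈ Finset.range n, (e K M + (-1) ^ (r + 1) * p K (r + 1) * e K (M - (r + 1)))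

theorem newtonSum_succ (K : Type) [CommRing K] (M n : ℕ) :
    newtonSum K M (n + 1) =
      newtonSum K M n + (e K M + (-1) ^ (n + 1) * p K (n + 1) * e K (M - (n + 1))) :=
  Finset.sum_range_succ _ _

/-- By induction on `n` with `n + k` fixed, from `p_mul_e_succ`. -/
theorem hookM_eq_newtonSum (K : Type) [CommRing K] (n k : ℕ) :
    (-1) ^ n * hookM K (n + 1) k =
      ((k : Sym K) + 1) * e K (n + 1 + k) + newtonSum K (n + 1 + k) n := by
  induction n generalizing k with
  | zero => simp [hookM_one, newtonSum, Algebra.smul_def, add_comm]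
  | succ n ih =>
    have h1 := ih (k + 1)
    have h2 : n + 1 + (k + 1) = n + 1 + 1 + k := by ring
    have h3 : n + 1 + 1 + k - (n + 1) = k + 1 := by omega
    rw [h2] at h1
    rw [newtonSum_succ, h3]
    push_cast at h1
    linear_combination (-1) ^ (n + 1) * -p_mul_e_succ K n k + h1

/-- The change of a term of `newtonSum_recursion` when `n` grows by one and `M` is fixed. -/
theorem opB_newtonSum_step (hq : q ≠ 0) {M n : ℕ} (hn : n + 2 ≤ M) {c : ℕ} (hc : c < n) :
    opB q (c + 1) (newtonSum K (M - (c + 1)) (n - c)) =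
      opB q (c + 1) (newtonSum K (M - (c + 1)) (n - (c + 1))) +
        (algebraMap K (Sym K) q * sg K M (c + 1) - sg K M (c + 2)) +
        (algebraMap K (Sym K) q * ((-1) ^ (n - c) * p K (n - c) * sg K (M - n + c) (c + 1)) -
          (-1) ^ (n - c) * p K (n - c) * sg K (M - n + c) (c + 2)) -
        algebraMap K (Sym K) (1 - q⁻¹ ^ (n - c)) *
          (algebraMap K (Sym K) q * sg K M (n + 1) - sg K M (n + 2)) := by
  obtain ⟨r, hr⟩ : ∃ r, n - c = r + 1 := ⟨n - c - 1, by omega⟩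
  have hr' : n - (c + 1) = r := by omega
  have h1 : M - (c + 1) - (r + 1) = M - (n + 1) := by omega
  have h2 : M - (n + 1) = M - n + c - (c + 1) := by omega
  have h3 : c + 1 + (r + 1) = n + 1 := by omega
  have h4 : ((-1) ^ (r + 1) * (-1) ^ (r + 1) : Sym K) = 1 :=
    neg_one_pow_mul_self _
  have h5 : ∀ P : Sym K, opB q (c + 1) ((-1) ^ (r + 1) * P) = (-1) ^ (r + 1) * opB q (c + 1) P := by
    intro P
    have h6 : ((-1) ^ (r + 1) : Sym K) = algebraMap K (Sym K) ((-1) ^ (r + 1)) := by simp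
    rw [h6, ← Algebra.smul_def, map_smul, Algebra.smul_def]
  have h7 := opB_e q hq (M := M - n + c) (c := c + 1) (by omega)
  rw [← h2] at h7
  rw [hr, hr', newtonSum_succ, map_add, map_add, opB_e q hq (by omega), mul_assoc, h5,
    opB_p_mul q hq, h1, h3, opB_e q hq (by omega : n + 1 ≤ M), h7]
  linear_combination -algebraMap K (Sym K) (1 - q⁻¹ ^ (r + 1)) *
          (algebraMap K (Sym K) q * sg K M (n + 1) - sg K M (n + 2)) * h4

/-- By induction on `n` with `M` fixed: the change of the sum over `c` is a combination of hook Schur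
functions, `pHookSum K M n` and `pHookSum K M (n + 1)`, which `pHookSum_eq` evaluates. -/
theorem newtonSum_recursion (hq : q ≠ 0) {M n : ℕ} (hn : n + 1 ≤ M) :
    newtonSum K M n =
      (∑ j ∈ Finset.range n, q⁻¹ ^ j) • sg K M (n + 1) +
        ∑ c ∈ Finset.range n, opB q (c + 1) (newtonSum K (M - (c + 1)) (n - (c + 1))) := by
  induction n with
  | zero => simp [newtonSum]
  | succ n ih =>
    set Q := algebraMap K (Sym K) q
    have hQ : ∑ c ∈ Finset.range n, algebraMap K (Sym K) (1 - q⁻¹ ^ (n - c)) =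
        n - algebraMap K (Sym K) (∑ j ∈ Finset.range n, q⁻¹ ^ (j + 1)) := by
      rw [← Finset.sum_range_reflect (fun j => q⁻¹ ^ (j + 1)), ← map_sum,
        Finset.sum_sub_distrib, map_sub]
      congr 1
      · simp
      · congr 1
        refine Finset.sum_congr rfl fun c hc => ?_
        rw [Finset.mem_range] at hc
        congr 1
        omega
    have hW : algebraMap K (Sym K) (∑ j ∈ Finset.range n, q⁻¹ ^ j) =
        Q * algebraMap K (Sym K) (∑ j ∈ Finset.range n, q⁻¹ ^ (j + 1)) := by
      rw [← map_mul, Finset.mul_sum]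
      congr 1
      refine Finset.sum_congr rfl fun c _ => ?_
      rw [pow_succ']
      field_simp
    have hZ := Finset.sum_range_succ (fun c => sg K M (c + 1)) n
    have hZ' := Finset.sum_range_succ' (fun c => sg K M (c + 1)) n
    obtain ⟨m, rfl⟩ : ∃ m, M = m + 1 := ⟨M - 1, by omega⟩
    have h1 := sg_one K m
    have hS := Finset.sum_congr rfl fun c hc =>
      opB_newtonSum_step q hq (M := m + 1) (n := n) hn (c := c) (Finset.mem_range.1 hc)
    simp only [Finset.sum_add_distrib, Finset.sum_sub_distrib, ← Finset.mul_sum,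
      ← Finset.sum_mul, hQ] at hS
    have hν := pHookSum_eq K (M := m + 1) (n := n) (by omega)
    have hν' := pHookSum_eq K (M := m + 1) (n := n + 1) hn
    rw [pHookSum_succ K hn, Finset.sum_range_succ _ (n + 1)] at hν'
    rw [pHookSum] at hν
    have h0 := ih (by omega)
    -- The last summand, `c = n`, is zero, as the sum that it contains is empty.
    rw [newtonSum_succ, Finset.sum_range_succ' (fun j => q⁻¹ ^ j), Finset.sum_range_succ _ n]
    simp only [Nat.add_sub_add_right, Nat.sub_self] at hS h0 hν' ⊢
    rw [hS]
    have h00 : newtonSum K (m - n) 0 = 0 := rfl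
    rw [Algebra.smul_def, hW] at h0
    rw [Algebra.smul_def, map_add, pow_zero, map_one, h00, map_zero, add_zero]
    push_cast at hν'
    simp only [zero_add, add_assoc, Nat.reduceAdd] at hZ hZ' hν hν' h0 h1 ⊢
    linear_combination h0 + Q * -hν + hν' + Q * hZ - hZ' - h1

end Recursion

/-! ### Solving the recursions by sums over compositions -/

/-- A recursion that strips off the first part of a composition is solved by the sum over
compositions. -/
theorem eq_sum_sumC (y : K) (x Ψ : ℕ → Sym K)
    (hΨ : ∀ n, Ψ n = x n +
      ∑ c ∈ Finset.range n, y ^ (c + 1) • opC q (c + 1) (Ψ (n - (c + 1)))) (n : ℕ) :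
    Ψ n = ∑ a ∈ Finset.range (n + 1), y ^ (n - a) • sumC q (n - a) (x a) := by
  induction n using Nat.strong_induction_on with
  | _ n ih =>
    rw [hΨ, Finset.sum_range_succ, Nat.sub_self, pow_zero, one_smul, sumC_zero,
      Module.End.one_apply, add_comm]
    congr 1
    have h1 : ∀ c ∈ Finset.range n, y ^ (c + 1) • opC q (c + 1) (Ψ (n - (c + 1))) =
        ∑ a ∈ Finset.range (n - c),
          y ^ (n - a) • opC q (c + 1) (sumC q (n - (c + 1) - a) (x a)) := by
      intro c hc
      rw [Finset.mem_range] at hc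
      rw [ih _ (by omega), map_sum, Finset.smul_sum, (by omega : n - (c + 1) + 1 = n - c)]
      refine Finset.sum_congr rfl fun a ha => ?_
      rw [Finset.mem_range] at ha
      rw [map_smul, smul_smul, ← pow_add]
      congr 2
      omega
    rw [Finset.sum_congr rfl h1, Finset.sum_comm' (t' := Finset.range n)
      (s' := fun a => Finset.range (n - a)) (by intro c a; simp only [Finset.mem_range]; omega)]
    refine Finset.sum_congr rfl fun a ha => ?_
    rw [Finset.mem_range] at ha
    obtain ⟨l, hl⟩ : ∃ l, n - a = l + 1 := ⟨n - a - 1, by omega⟩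
    rw [← Finset.smul_sum, hl, sumC_succ, LinearMap.sum_apply]
    refine congrArg (y ^ (l + 1) • ·) (Finset.sum_congr rfl fun c _ => ?_)
    rw [Module.End.mul_apply, (by omega : n - (c + 1) - a = l - c)]

/-- The recursion of `sum_opC_e_eq_e`, cut at total size `n`, has the tail `sum_opC_e`. -/
theorem e_eq_sum_sumC (hq : q ≠ 0) (n k : ℕ) :
    e K (n + 1 + k) = ∑ a ∈ Finset.range (n + 1),
      sumC q (n - a) (q⁻¹ ^ a • sg K (a + 1 + k) (a + 1)) := by
  have hΨ : ∀ n, e K (n + 1 + k) = q⁻¹ ^ n • sg K (n + 1 + k) (n + 1) +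
      ∑ c ∈ Finset.range n, (1 : K) ^ (c + 1) • opC q (c + 1) (e K (n - (c + 1) + 1 + k)) := by
    intro n
    have h2 := sum_opC_e_eq_e q hq (n + k)
    rw [add_assoc n k 1, Finset.sum_range_add, (by ring : n + (k + 1) = n + 1 + k)] at h2
    rw [← h2, add_comm]
    congr 1
    · rw [← sum_opC_e q hq]
      refine Finset.sum_congr rfl fun b _ => ?_
      rw [add_right_comm n b 1, Nat.add_sub_add_left]
    · refine Finset.sum_congr rfl fun c hc => ?_
      rw [Finset.mem_range] at hc
      rw [one_pow, one_smul, (by omega : n - (c + 1) + 1 + k = n + k - c)]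
  have h1 := eq_sum_sumC q 1 (fun a => q⁻¹ ^ a • sg K (a + 1 + k) (a + 1))
    (fun n => e K (n + 1 + k)) hΨ n
  simp only [one_pow, one_smul] at h1
  exact h1

/-- The weight of the term with index `a` is `q ^ (n - a)`, from the composition, times
`q ^ a (1 + q⁻¹ + ⋯ + q ^ (1 - a))`. -/
theorem newtonSum_eq_sum_sumC (hq : q ≠ 0) (n k : ℕ) :
    newtonSum K (n + 1 + k) n = ∑ a ∈ Finset.range (n + 1),
      (∑ j ∈ Finset.range a, q ^ (n - j)) •
        sumC q (n - a) (q⁻¹ ^ a • sg K (a + 1 + k) (a + 1)) := by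
  have hΨ : ∀ n, newtonSum K (n + 1 + k) n =
      (∑ j ∈ Finset.range n, q⁻¹ ^ j) • sg K (n + 1 + k) (n + 1) +
        ∑ c ∈ Finset.range n,
          q ^ (c + 1) • opC q (c + 1) (newtonSum K (n - (c + 1) + 1 + k) (n - (c + 1))) := by
    intro n
    rw [newtonSum_recursion q hq (by omega)]
    refine congrArg (_ + ·) (Finset.sum_congr rfl fun c hc => ?_)
    rw [Finset.mem_range] at hc
    rw [(by omega : n + 1 + k - (c + 1) = n - (c + 1) + 1 + k), opB_apply]
  rw [eq_sum_sumC q q (fun a => (∑ j ∈ Finset.range a, q⁻¹ ^ j) • sg K (a + 1 + k) (a + 1))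
    (fun n => newtonSum K (n + 1 + k) n) hΨ n]
  refine Finset.sum_congr rfl fun a ha => ?_
  rw [Finset.mem_range] at ha
  rw [map_smul, map_smul, smul_smul, smul_smul, Finset.mul_sum, Finset.sum_mul]
  refine congrArg (· • _) (Finset.sum_congr rfl fun j hj => ?_)
  rw [Finset.mem_range] at hj
  rw [inv_pow, inv_pow, ← div_eq_mul_inv, ← div_eq_mul_inv,
    div_eq_div_iff (pow_ne_zero _ hq) (pow_ne_zero _ hq), ← pow_add, ← pow_add]
  congr 1
  omega

theorem sum_compC_opC_compC (hq : q ≠ 0) (N a k : ℕ) :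
    ∑ τ : Composition N, ∑ b ∈ Finset.Icc 0 k, ∑ ρ : Composition (k - b),
        compC q τ (opC q (a + 1 + b) (compC q ρ 1)) =
      sumC q N (q⁻¹ ^ a • sg K (a + 1 + k) (a + 1)) := by
  rw [← sum_opC_e q hq, sumC, LinearMap.sum_apply, ← Nat.range_succ_eq_Icc_zero]
  refine Finset.sum_congr rfl fun τ _ => ?_
  rw [map_sum]
  refine Finset.sum_congr rfl fun b _ => ?_
  rw [← sumC_one q hq, sumC, LinearMap.sum_apply, map_sum, map_sum]

end SymFn

end

theorem theorem4p1 (n k : ℕ) (hn : 2 ≤ n) (hk : 1 ≤ k) :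
    ((-1) ^ (n - 1) * SymFn.m (RatFunc ℚ) (n ::ₘ Multiset.replicate k 1) :
        SymFn.Sym (RatFunc ℚ)) =
      ∑ a ∈ Finset.Icc 1 n,
        ((k : RatFunc ℚ) + 1 + ∑ i ∈ Finset.Icc 1 (a - 1), RatFunc.X ^ (n - i)) •
          ∑ τ : Composition (n - a), ∑ b ∈ Finset.Icc 0 k, ∑ ρ : Composition (k - b),
            SymFn.compC RatFunc.X τ (SymFn.opC RatFunc.X (a + b) (SymFn.compC RatFunc.X ρ 1)) := by
  have hX : (RatFunc.X : RatFunc ℚ) ≠ 0 := RatFunc.X_ne_zero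
  have hIcc : ∀ {M : Type} [AddCommMonoid M] (N : ℕ) (f : ℕ → M),
      ∑ i ∈ Finset.Icc 1 N, f i = ∑ i ∈ Finset.range N, f (i + 1) := by
    intro M _ N f
    rw [Finset.range_eq_Ico, Finset.sum_Ico_add' f 0 N 1]
    rfl
  obtain ⟨N, rfl⟩ : ∃ N, n = N + 1 := ⟨n - 1, by omega⟩
  -- The `k + 1` of each weight accounts for `(k + 1) e_{n+k}`, the powers of `q` for `newtonSum`.
  rw [← SymFn.hookM_of_two_le _ hn, Nat.add_sub_cancel, SymFn.hookM_eq_newtonSum,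
    SymFn.newtonSum_eq_sum_sumC RatFunc.X hX, SymFn.e_eq_sum_sumC RatFunc.X hX, hIcc,
    Finset.mul_sum, ← Finset.sum_add_distrib]
  refine Finset.sum_congr rfl fun a _ => ?_
  rw [SymFn.sum_compC_opC_compC RatFunc.X hX, hIcc, add_smul, Nat.add_sub_add_right,
    Nat.add_sub_cancel]
  simp only [Nat.add_sub_add_right]
  have hk' : ((k : SymFn.Sym (RatFunc ℚ)) + 1) =
      algebraMap (RatFunc ℚ) _ ((k : RatFunc ℚ) + 1) := by
    simp
  rw [hk', ← Algebra.smul_def]
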